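/- Let $\kappa$ be an infinite cardinal and $\mathbb{K}\in\{\mathbb{R},\mathbb{C}\}$. A \emph{family} on $\kappa$ is a set of finite subsets of $\kappa$ which contains every subset of $\kappa$ with at most one element; it is \emph{hereditary} if it is closed under subsets, and \emph{compact} if, identifying sets with their characteristic functions, it is a closed subset of $2^\kappa$ with the product topology. For a family $\mathcal{F}$, let $\mathcal{F}^{MAX}$ be the set of its maximal elements with respect to inclusion, let $\overline{\mathcal{F}^{MAX}}$ be the closure of $\mathcal{F}^{MAX}$ in $2^\kappa$, and let $X_{\mathcal{F}}$ be the completion of the space $c_{00}(\kappa)$ of finitely supported functions $x:\kappa\to\mathbb{K}$ with respect to the norm $$\|x\|=\sup\Big\{\sum_{\alpha\in s}|x(\alpha)| : s\in\mathcal{F}\Big\},$$ with canonical unit vectors $e_\alpha$, $\alpha\in\kappa$. \textbf{Theorem.} Let $\mathcal{F}$ and $\mathcal{G}$ be compact and hereditary families on $\kappa$ such that $\{\alpha\}\in\overline{\mathcal{F}^{MAX}}\cap\overline{\mathcal{G}^{MAX}}$ for every $\alpha\in\kappa$. If $T:X_{\mathcal{F}}\to X_{\mathcal{G}}$ is a bijective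 $\mathbb{K}$-linear operator which preserves the norm, then there exist a permutation $\pi$ of $\kappa$ and scalars $\theta_\alpha\in\mathbb{K}$ with $|\theta_\alpha|=1$ ($\alpha\in\kappa$) such that $Te_\alpha=\theta_\alpha e_{\pi(\alpha)}$ for all $\alpha\in\kappa$. -/

import Mathlib

namespace CombinatorialSpace

universe u v

/-- A family on `κ`: a set of finite subsets of `κ` that contains every subset with at most one
element. -/
structure Family (κ : Type u) where
  /-- The members of the family. -/
  sets : Set (Finset κ)
  mem_of_card_le_one : ∀ s : Finset κ, s.card ≤ 1 → s ∈ sets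

/-- A family is hereditary if it is closed under subsets. -/
def Family.Hereditary {κ : Type u} (F : Family κ) : Prop :=
  ∀ t ∈ F.sets, ∀ s : Finset κ, s ⊆ t → s ∈ F.sets

/-- The maximal elements of a family with respect to inclusion. -/
def Family.maxSets {κ : Type u} (F : Family κ) : Set (Finset κ) :=
  {s | s ∈ F.sets ∧ ¬ ∃ t ∈ F.sets, s ⊂ t}

open Classical in
/-- The characteristic function of a finite subset of `κ`, as a point of the Cantor cube `2^κ`
(the function type carries the product topology, `Bool` is discrete). -/
noncomputable def charFun {κ : Type u} (s : Finset κ) : κ → Bool :=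
  fun α => decide (α ∈ s)

/-- A family is compact if it is a closed subspace of `2^κ`. -/
def Family.Compact {κ : Type u} (F : Family κ) : Prop :=
  IsClosed (charFun '' F.sets)

/-- The closure in `2^κ` of the set of maximal elements of a family. -/
def Family.closureMax {κ : Type u} (F : Family κ) : Set (κ → Bool) :=
  closure (charFun '' F.maxSets)

/-- The space `c₀₀(κ)` of finitely supported scalar functions on `κ`, to be normed through the
family `F`. -/
def C00 (𝕜 : Type v) [RCLike 𝕜] {κ : Type u} (_F : Family κ) : Type (max u v) := κ →₀ 𝕜

section Norm

variable {𝕜 : Type v} [RCLike 𝕜] {κ : Type u} {F : Family κ}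

noncomputable instance : AddCommGroup (C00 𝕜 F) := inferInstanceAs (AddCommGroup (κ →₀ 𝕜))

noncomputable instance : Module 𝕜 (C00 𝕜 F) := inferInstanceAs (Module 𝕜 (κ →₀ 𝕜))

/-- The value of `x` at the coordinate `α`. -/
def C00.coord (x : C00 𝕜 F) (α : κ) : 𝕜 := (show κ →₀ 𝕜 from x) α

/-- The norm `‖x‖ = sup {∑_{α ∈ s} |x(α)| : s ∈ F}`. -/
noncomputable instance : Norm (C00 𝕜 F) where
  norm x := sSup {r : ℝ | ∃ s ∈ F.sets, r = ∑ α ∈ s, ‖x.coord α‖}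

theorem C00.norm_def (x : C00 𝕜 F) :
    ‖x‖ = sSup {r : ℝ | ∃ s ∈ F.sets, r = ∑ α ∈ s, ‖x.coord α‖} := rfl

theorem C00.coord_add (x y : C00 𝕜 F) (α : κ) :
    (x + y).coord α = x.coord α + y.coord α := rfl

theorem C00.coord_smul (c : 𝕜) (x : C00 𝕜 F) (α : κ) :
    (c • x).coord α = c * x.coord α := rfl

theorem C00.bddAbove (x : C00 𝕜 F) :
    BddAbove {r : ℝ | ∃ s ∈ F.sets, r = ∑ α ∈ s, ‖x.coord α‖} := by
  classical
  refine ⟨∑ α ∈ (show κ →₀ 𝕜 from x).support, ‖x.coord α‖, ?_⟩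
  rintro r ⟨s, -, rfl⟩
  rw [← Finset.sum_filter_add_sum_filter_not s
    (fun α => α ∈ (show κ →₀ 𝕜 from x).support)]
  have h0 : ∑ α ∈ s.filter (fun α => ¬ α ∈ (show κ →₀ 𝕜 from x).support),
      ‖x.coord α‖ = 0 := by
    refine Finset.sum_eq_zero fun α hα => ?_
    have h1 : (show κ →₀ 𝕜 from x) α = 0 :=
      Finsupp.notMem_support_iff.mp (Finset.mem_filter.mp hα).2
    have h2 : x.coord α = 0 := h1
    rw [h2, norm_zero]
  rw [h0, add_zero]
  exact Finset.sum_le_sum_of_subset_of_nonneg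
    (fun α hα => (Finset.mem_filter.mp hα).2) (fun _ _ _ => norm_nonneg _)

theorem C00.sum_le_norm (x : C00 𝕜 F) {s : Finset κ} (hs : s ∈ F.sets) :
    ∑ α ∈ s, ‖x.coord α‖ ≤ ‖x‖ :=
  le_csSup x.bddAbove ⟨s, hs, rfl⟩

theorem C00.norm_le (x : C00 𝕜 F) {b : ℝ}
    (h : ∀ s ∈ F.sets, ∑ α ∈ s, ‖x.coord α‖ ≤ b) : ‖x‖ ≤ b := by
  refine csSup_le ⟨_, ∅, F.mem_of_card_le_one ∅ (by simp), rfl⟩ ?_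
  rintro r ⟨s, hs, rfl⟩
  exact h s hs

theorem C00.norm_coord_le (x : C00 𝕜 F) (α : κ) : ‖x.coord α‖ ≤ ‖x‖ := by
  have h := x.sum_le_norm (F.mem_of_card_le_one {α} (by simp))
  simpa using h

theorem C00.norm_nonneg' (x : C00 𝕜 F) : 0 ≤ ‖x‖ := by
  have h := x.sum_le_norm (F.mem_of_card_le_one ∅ (by simp))
  simpa using h

theorem C00.norm_smul_le' (c : 𝕜) (x : C00 𝕜 F) : ‖c • x‖ ≤ ‖c‖ * ‖x‖ := by
  refine C00.norm_le _ fun s hs => ?_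
  simp only [C00.coord_smul, norm_mul, ← Finset.mul_sum]
  exact mul_le_mul_of_nonneg_left (x.sum_le_norm hs) (norm_nonneg c)

theorem C00.core : NormedSpace.Core 𝕜 (C00 𝕜 F) where
  norm_nonneg := C00.norm_nonneg'
  norm_smul c x := by
    refine le_antisymm (C00.norm_smul_le' c x) ?_
    rcases eq_or_ne c 0 with rfl | hc
    · simpa using C00.norm_nonneg' ((0 : 𝕜) • x)
    · have h := C00.norm_smul_le' c⁻¹ (c • x)
      rw [smul_smul, inv_mul_cancel₀ hc, one_smul, norm_inv] at h
      have hc' : 0 < ‖c‖ := norm_pos_iff.mpr hc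
      calc ‖c‖ * ‖x‖ ≤ ‖c‖ * (‖c‖⁻¹ * ‖c • x‖) := mul_le_mul_of_nonneg_left h hc'.le
        _ = ‖c • x‖ := by rw [← mul_assoc, mul_inv_cancel₀ hc'.ne', one_mul]
  norm_triangle x y := by
    refine C00.norm_le _ fun s hs => ?_
    calc ∑ α ∈ s, ‖(x + y).coord α‖ ≤ ∑ α ∈ s, (‖x.coord α‖ + ‖y.coord α‖) :=
          Finset.sum_le_sum fun α _ => norm_add_le _ _
      _ = ∑ α ∈ s, ‖x.coord α‖ + ∑ α ∈ s, ‖y.coord α‖ := Finset.sum_add_distrib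
      _ ≤ ‖x‖ + ‖y‖ := add_le_add (x.sum_le_norm hs) (y.sum_le_norm hs)
  norm_eq_zero_iff x := by
    constructor
    · intro h
      refine Finsupp.ext fun α => ?_
      have h1 := x.norm_coord_le α
      rw [h] at h1
      exact norm_le_zero_iff.mp h1
    · rintro rfl
      refine le_antisymm (C00.norm_le _ fun s _ => ?_) (C00.norm_nonneg' _)
      refine (Finset.sum_eq_zero fun α _ => ?_).le
      exact norm_eq_zero.mpr rfl

noncomputable instance : NormedAddCommGroup (C00 𝕜 F) := NormedAddCommGroup.ofCore C00.core

noncomputable instance : NormedSpace 𝕜 (C00 𝕜 F) := NormedSpace.ofCore C00.core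

end Norm

/-- The combinatorial Banach space `X_F` over `𝕜`: the completion of `c₀₀(κ)` with respect to the
norm given by `F`. -/
abbrev X (𝕜 : Type v) [RCLike 𝕜] {κ : Type u} (F : Family κ) : Type (max u v) :=
  UniformSpace.Completion (C00 𝕜 F)

/-- The canonical unit vector `e_α` of `c₀₀(κ)`. -/
noncomputable def C00.unit (𝕜 : Type v) [RCLike 𝕜] {κ : Type u} (F : Family κ) (α : κ) :
    C00 𝕜 F :=
  (Finsupp.single α 1 : κ →₀ 𝕜)

/-- The canonical unit vector `e_α` of `X_F`. -/
noncomputable def X.e (𝕜 : Type v) [RCLike 𝕜] {κ : Type u} (F : Family κ) (α : κ) : X 𝕜 F :=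
  ((C00.unit 𝕜 F α : C00 𝕜 F) : UniformSpace.Completion (C00 𝕜 F))

end CombinatorialSpace

/-!
An isometry `T : X_F → X_G` induces a weak* homeomorphism `f ↦ f ∘ T` of the dual spaces that maps
dual ball onto dual ball. It therefore maps `K_G` onto `K_F`, where `K` denotes the weak* closure of
the set of extreme points of the dual ball (`adjoint_mem_extremeClosure`). Three facts on `K_F` are
used.

* Every coordinate of an element of `K_F` has modulus `0` or `1`
  (`norm_apply_e_of_mem_extremeClosure`). By the Hahn–Banach theorem every functional in the ball is
  a convex combination of one that vanishes at `e_β` and one whose value at `e_β` may be replaced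
  by any scalar of modulus at most one; an extreme point is one of the two, and then its value at
  `e_β` is `0` or unimodular. This property passes to weak* limits.
* Every coordinate functional `e*_α` lies in `K_F` (`coord_mem_extremeClosure`). If `s` is maximal,
  `∑_{α ∈ s} e*_α` is an extreme point, and by weak* compactness of the ball these functionals
  converge to `e*_α` when `s` converges to `{α}`.
* `K_F` is invariant under a change of sign of a single coordinate, since this is the adjoint of an
  isometry of `X_F` (`sub_smul_coord_mem_extremeClosure`).

Now let `g = e*_α ∘ T ∈ K_F`, let `β` be a coordinate with `g(e_β) ≠ 0`, hence unimodular, and let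
`f = e*_β ∘ T⁻¹ ∈ K_G`. Changing the sign of the coordinate `β` of `g` and going back to `X_G` gives
`e*_α - 2 g(e_β) f ∈ K_G`. For `γ ≠ α` both `|f(e_γ)|` and `2 |f(e_γ)|` are in `{0, 1}`, so
`f(e_γ) = 0`. Thus `f` is a unimodular multiple of `e*_α`. Applying this to `T` and to `T⁻¹` gives
the permutation and the scalars, because the coordinates separate the points of `X_G`.
-/

namespace CombinatorialSpace

open Filter Topology UniformSpace

/-! ### The dual ball in the weak* topology -/

section DualBall

variable (𝕜 : Type*) [RCLike 𝕜] (E : Type*) [NormedAddCommGroup E] [NormedSpace 𝕜 E]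

/- The weak* dual inherits its real vector space structure along several paths. The next three
instances fix the one that general lemmas on real vector spaces arrive at, so that these lemmas
unify without unfolding `WeakDual`. -/

noncomputable instance : AddCommMonoid (WeakDual 𝕜 E) := AddCommGroup.toAddCommMonoid

noncomputable instance : Module ℝ (WeakDual 𝕜 E) := WeakDual.instModule' ℝ

noncomputable instance : SMul ℝ (WeakDual 𝕜 E) := SMulZeroClass.toSMul

instance : IsScalarTower ℝ 𝕜 (WeakDual 𝕜 E) :=
  inferInstanceAs (IsScalarTower ℝ 𝕜 (E →L[𝕜] 𝕜))

instance : LocallyConvexSpace ℝ (WeakDual 𝕜 E) :=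
  inferInstanceAs (LocallyConvexSpace ℝ (WeakBilin (topDualPairing 𝕜 E)))

/-- The closed unit ball of the dual of `E`, as a subset of the dual with its weak* topology. -/
def dualBall : Set (WeakDual 𝕜 E) := {f | ∀ x, ‖f x‖ ≤ ‖x‖}

/-- The weak* closure of the set of extreme points (over `ℝ`) of the dual unit ball of `E`. -/
def extremeClosure : Set (WeakDual 𝕜 E) := closure ((dualBall 𝕜 E).extremePoints ℝ)

variable {𝕜 E}

theorem isCompact_dualBall : IsCompact (dualBall 𝕜 E) := by
  convert WeakDual.isCompact_closedBall (𝕜 := 𝕜) (E := E) 0 1 using 1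
  ext f
  simp only [Set.mem_preimage, mem_closedBall_zero_iff]
  rw [ContinuousLinearMap.opNorm_le_iff zero_le_one]
  simp [dualBall]

theorem isClosed_dualBall : IsClosed (dualBall 𝕜 E) := isCompact_dualBall.isClosed

theorem weakDual_real_smul_apply (a : ℝ) (f : WeakDual 𝕜 E) (x : E) : (a • f) x = a • f x := rfl

theorem weakDual_add_apply (f g : WeakDual 𝕜 E) (x : E) : (f + g) x = f x + g x := rfl

theorem weakDual_smul_apply (a : 𝕜) (f : WeakDual 𝕜 E) (x : E) : (a • f) x = a * f x := rfl

theorem weakDual_sub_apply (f g : WeakDual 𝕜 E) (x : E) : (f - g) x = f x - g x := rfl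

theorem convex_dualBall : Convex ℝ (dualBall 𝕜 E) := by
  intro f hf g hg a b ha hb hab x
  calc ‖a • f x + b • g x‖ ≤ a * ‖x‖ + b * ‖x‖ := by
        refine (norm_add_le _ _).trans ?_
        rw [norm_smul, norm_smul, Real.norm_of_nonneg ha, Real.norm_of_nonneg hb]
        exact add_le_add (mul_le_mul_of_nonneg_left (hf x) ha)
          (mul_le_mul_of_nonneg_left (hg x) hb)
    _ = ‖x‖ := by rw [← add_mul, hab, one_mul]

variable {E' : Type*} [NormedAddCommGroup E'] [NormedSpace 𝕜 E']

/-- The adjoint `f ↦ f ∘ T` of a linear isometric equivalence, as a map between the weak* duals. -/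
noncomputable def adjoint (T : E ≃ₗᵢ[𝕜] E') : WeakDual 𝕜 E' ≃ₗ[𝕜] WeakDual 𝕜 E where
  toFun f := StrongDual.toWeakDual
    ((WeakDual.toStrongDual f).comp (T.toContinuousLinearEquiv : E →L[𝕜] E'))
  invFun f := StrongDual.toWeakDual
    ((WeakDual.toStrongDual f).comp (T.symm.toContinuousLinearEquiv : E' →L[𝕜] E))
  map_add' _ _ := rfl
  map_smul' _ _ := rfl
  left_inv f := DFunLike.ext _ _ fun x => congrArg f (T.apply_symm_apply x)
  right_inv f := DFunLike.ext _ _ fun x => congrArg f (T.symm_apply_apply x)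

theorem adjoint_apply (T : E ≃ₗᵢ[𝕜] E') (f : WeakDual 𝕜 E') (x : E) : adjoint T f x = f (T x) := rfl

theorem adjoint_symm_apply (T : E ≃ₗᵢ[𝕜] E') (f : WeakDual 𝕜 E) (x : E') :
    (adjoint T).symm f x = f (T.symm x) := rfl

/-- The adjoint of an isometry is a weak* homeomorphism that carries dual ball to dual ball, hence
it preserves extreme points and the closure of their set. -/
theorem adjoint_mem_extremeClosure (T : E ≃ₗᵢ[𝕜] E') {f : WeakDual 𝕜 E'}
    (hf : f ∈ extremeClosure 𝕜 E') : adjoint T f ∈ extremeClosure 𝕜 E := by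
  have hcont : Continuous (adjoint T) :=
    WeakDual.continuous_of_continuous_eval fun x => WeakDual.eval_continuous (T x)
  have himage : adjoint T '' dualBall 𝕜 E' = dualBall 𝕜 E := by
    ext g
    constructor
    · rintro ⟨f, hf, rfl⟩ x
      simpa [adjoint_apply] using hf (T x)
    · intro hg
      refine ⟨(adjoint T).symm g, fun x => ?_, (adjoint T).apply_symm_apply g⟩
      simpa [adjoint_symm_apply] using hg (T.symm x)
  have hext := image_extremePoints (𝕜 := ℝ) ((adjoint T).restrictScalars ℝ) (dualBall 𝕜 E')
  simp only [LinearEquiv.restrictScalars_apply, himage] at hext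
  have := image_closure_subset_closure_image (s := (dualBall 𝕜 E').extremePoints ℝ) hcont
    ⟨f, hf, rfl⟩
  rwa [hext] at this

theorem adjoint_symm_mem_extremeClosure (T : E ≃ₗᵢ[𝕜] E') {f : WeakDual 𝕜 E}
    (hf : f ∈ extremeClosure 𝕜 E) : (adjoint T).symm f ∈ extremeClosure 𝕜 E' :=
  adjoint_mem_extremeClosure T.symm hf

/-- The Hahn–Banach theorem for the weak* topology: a point outside a closed convex set of
functionals is separated from it by an evaluation. -/
theorem exists_eval_separation {s : Set (WeakDual 𝕜 E)} (hs : Convex ℝ s) (hs' : IsClosed s)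
    {f : WeakDual 𝕜 E} (hf : f ∉ s) :
    ∃ (x : E) (u : ℝ), (∀ g ∈ s, RCLike.re (g x) < u) ∧ u < RCLike.re (f x) := by
  have eval (φ : WeakDual 𝕜 E →L[𝕜] 𝕜) : ∃ x : E, ∀ g, φ g = g x := by
    obtain ⟨x, hx⟩ := LinearMap.dualEmbedding_surjective (topDualPairing 𝕜 E) φ
    exact ⟨x, fun g => (DFunLike.congr_fun hx g).symm⟩
  refine Exists.elim (@RCLike.geometric_hahn_banach_closed_point 𝕜 (WeakDual 𝕜 E) _ _ _ s f _ _
    inferInstance inferInstance inferInstance inferInstance hs hs' hf) fun φ ⟨u, h1, h2⟩ => ?_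
  obtain ⟨x, hx⟩ := eval φ
  exact ⟨x, u, fun g hg => hx g ▸ h1 g hg, hx f ▸ h2⟩

theorem isCompact_convexJoin {s t : Set (WeakDual 𝕜 E)} (hs : IsCompact s) (ht : IsCompact t) :
    IsCompact (convexJoin ℝ s t) := by
  have h : convexJoin ℝ s t =
      (fun p : ℝ × WeakDual 𝕜 E × WeakDual 𝕜 E => (1 - p.1) • p.2.1 + p.1 • p.2.2) ''
        (Set.Icc 0 1 ×ˢ s ×ˢ t) := by
    ext f
    simp only [mem_convexJoin, segment_eq_image, Set.mem_image, Set.mem_prod, Prod.exists]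
    constructor
    · rintro ⟨a, ha, b, hb, r, hr, rfl⟩
      exact ⟨r, a, b, ⟨hr, ha, hb⟩, rfl⟩
    · rintro ⟨r, a, b, ⟨hr, ha, hb⟩, rfl⟩
      exact ⟨a, ha, b, hb, r, hr, rfl⟩
  rw [h]
  exact (isCompact_Icc.prod (hs.prod ht)).image (by fun_prop)

theorem exists_eval_separation_convexJoin {s t : Set (WeakDual 𝕜 E)} (hs : Convex ℝ s)
    (hs' : IsCompact s) (ht : Convex ℝ t) (ht' : IsCompact t) {f : WeakDual 𝕜 E}
    (hf : f ∉ convexJoin ℝ s t) :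
    ∃ (x : E) (u : ℝ), (∀ g ∈ convexJoin ℝ s t, RCLike.re (g x) < u) ∧ u < RCLike.re (f x) :=
  exists_eval_separation (hs.convexJoin ht) (isCompact_convexJoin hs' ht').isClosed hf

end DualBall

/-! ### Coordinate functionals -/

section Coordinates

variable {𝕜 : Type*} [RCLike 𝕜] {κ : Type*} {F : Family κ}

theorem C00.coord_unit [DecidableEq κ] (α β : κ) :
    (C00.unit 𝕜 F α).coord β = if α = β then 1 else 0 :=
  Finsupp.single_apply

/-- The unit vectors span `c₀₀(κ)`. -/
theorem C00.induction {p : C00 𝕜 F → Prop} (zero : p 0)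
    (add : ∀ x y, p x → p y → p (x + y)) (unit : ∀ (c : 𝕜) α, p (c • C00.unit 𝕜 F α))
    (x : C00 𝕜 F) : p x := by
  refine Finsupp.induction_linear (motive := p) x zero add fun α c => ?_
  have h : (c • C00.unit 𝕜 F α : C00 𝕜 F) = (Finsupp.single α c : κ →₀ 𝕜) :=
    (Finsupp.smul_single c α 1).trans (by rw [smul_eq_mul, mul_one])
  exact h ▸ unit c α

/-- The coordinate functional `e*_α` on `c₀₀(κ)`. -/
noncomputable def C00.coordCLM (𝕜 : Type*) [RCLike 𝕜] {κ : Type*} (F : Family κ) (α : κ) :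
    C00 𝕜 F →L[𝕜] 𝕜 :=
  LinearMap.mkContinuous
    { toFun := fun x => x.coord α
      map_add' := fun x y => x.coord_add y α
      map_smul' := fun c x => x.coord_smul c α } 1
    fun x => by simpa using x.norm_coord_le α

/-- The coordinate functional `e*_α` on `X_F`, as a point of the weak* dual. -/
noncomputable def X.coord (𝕜 : Type*) [RCLike 𝕜] {κ : Type*} (F : Family κ) (α : κ) :
    WeakDual 𝕜 (X 𝕜 F) :=
  StrongDual.toWeakDual ((C00.coordCLM 𝕜 F α).extend Completion.toComplL)

theorem X.coord_coe (α : κ) (x : C00 𝕜 F) : X.coord 𝕜 F α (x : X 𝕜 F) = x.coord α :=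
  ContinuousLinearMap.extend_eq _ Completion.denseRange_coe
    (Completion.isUniformInducing_coe _) x

theorem X.coord_e [DecidableEq κ] (α β : κ) :
    X.coord 𝕜 F α (X.e 𝕜 F β) = if β = α then 1 else 0 :=
  (X.coord_coe α _).trans (C00.coord_unit β α)

theorem X.coord_e_self (α : κ) : X.coord 𝕜 F α (X.e 𝕜 F α) = 1 := by
  classical
  rw [X.coord_e, if_pos rfl]

theorem X.coord_e_of_ne {α β : κ} (h : α ≠ β) : X.coord 𝕜 F α (X.e 𝕜 F β) = 0 := by
  classical
  rw [X.coord_e, if_neg h.symm]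

theorem X.norm_e_le (α : κ) : ‖X.e 𝕜 F α‖ ≤ 1 := by
  classical
  rw [X.e, Completion.norm_coe]
  refine C00.norm_le _ fun s _ => ?_
  simp only [C00.coord_unit, apply_ite norm, norm_one, norm_zero]
  rw [Finset.sum_ite_eq]
  split_ifs <;> norm_num

theorem X.functional_ext {f g : WeakDual 𝕜 (X 𝕜 F)}
    (h : ∀ α, f (X.e 𝕜 F α) = g (X.e 𝕜 F α)) : f = g := by
  refine DFunLike.ext _ _ fun x => ?_
  induction x using Completion.induction_on with
  | hp => exact isClosed_eq (map_continuous f) (map_continuous g)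
  | ih x =>
    induction x using C00.induction with
    | zero => rw [Completion.coe_zero, map_zero, map_zero]
    | add x y hx hy => rw [Completion.coe_add, map_add, map_add, hx, hy]
    | unit c α =>
      rw [Completion.coe_smul, map_smul, map_smul]
      exact congrArg (c • ·) (h α)

theorem X.sum_norm_coord_le {s : Finset κ} (hs : s ∈ F.sets) (x : X 𝕜 F) :
    ∑ α ∈ s, ‖X.coord 𝕜 F α x‖ ≤ ‖x‖ := by
  induction x using Completion.induction_on with
  | hp =>
    exact isClosed_le (continuous_finsetSum _ fun α _ => (map_continuous (X.coord 𝕜 F α)).norm)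
      continuous_norm
  | ih x => simpa only [X.coord_coe, Completion.norm_coe] using x.sum_le_norm hs

/-- The norm of the completion is still the supremum of the sums over the members of `F`. -/
theorem X.norm_le {x : X 𝕜 F} {b : ℝ}
    (h : ∀ s ∈ F.sets, ∑ α ∈ s, ‖X.coord 𝕜 F α x‖ ≤ b) : ‖x‖ ≤ b := by
  refine le_of_forall_pos_le_add fun ε hε => ?_
  obtain ⟨y, hy⟩ := Completion.denseRange_coe.exists_dist_lt x (half_pos hε)
  rw [dist_eq_norm] at hy
  have hyb : ‖(y : X 𝕜 F)‖ ≤ b + ε / 2 := by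
    rw [Completion.norm_coe]
    refine C00.norm_le _ fun s hs => ?_
    calc ∑ α ∈ s, ‖y.coord α‖
        ≤ ∑ α ∈ s, (‖X.coord 𝕜 F α x‖ + ‖X.coord 𝕜 F α (x - y)‖) := by
          refine Finset.sum_le_sum fun α _ => ?_
          rw [← X.coord_coe (F := F), map_sub]
          exact norm_le_norm_add_norm_sub _ _
      _ = ∑ α ∈ s, ‖X.coord 𝕜 F α x‖ + ∑ α ∈ s, ‖X.coord 𝕜 F α (x - y)‖ :=
          Finset.sum_add_distrib
      _ ≤ b + ε / 2 := add_le_add (h s hs) ((X.sum_norm_coord_le hs _).trans hy.le)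
  have h3 : ‖x‖ ≤ ‖(y : X 𝕜 F)‖ + ‖x - y‖ := by
    simpa using norm_add_le (y : X 𝕜 F) (x - y)
  linarith

/-- The coordinates separate the points of `X_F`. -/
theorem X.coord_ext {x y : X 𝕜 F} (h : ∀ α, X.coord 𝕜 F α x = X.coord 𝕜 F α y) : x = y := by
  refine sub_eq_zero.mp (norm_le_zero_iff.mp (X.norm_le fun s _ => ?_))
  simp [h]

/-- The functional `∑_{α ∈ s} θ_α e*_α`. -/
noncomputable def sumFunctional (𝕜 : Type*) [RCLike 𝕜] {κ : Type*} (F : Family κ)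
    (s : Finset κ) (θ : κ → 𝕜) : WeakDual 𝕜 (X 𝕜 F) :=
  ∑ α ∈ s, θ α • X.coord 𝕜 F α

theorem sumFunctional_apply (s : Finset κ) (θ : κ → 𝕜) (x : X 𝕜 F) :
    sumFunctional 𝕜 F s θ x = ∑ α ∈ s, θ α * X.coord 𝕜 F α x := by
  classical
  induction s using Finset.induction_on with
  | empty => rfl
  | insert β s hβ ih =>
    rw [Finset.sum_insert hβ, ← ih, sumFunctional, Finset.sum_insert hβ]
    rfl

theorem sumFunctional_e [DecidableEq κ] (s : Finset κ) (θ : κ → 𝕜) (β : κ) :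
    sumFunctional 𝕜 F s θ (X.e 𝕜 F β) = if β ∈ s then θ β else 0 := by
  rw [sumFunctional_apply]
  simp only [X.coord_e, mul_ite, mul_one, mul_zero]
  exact Finset.sum_ite_eq s β θ

theorem sumFunctional_mem_dualBall {s : Finset κ} (hs : s ∈ F.sets) {θ : κ → 𝕜}
    (hθ : ∀ α, ‖θ α‖ ≤ 1) : sumFunctional 𝕜 F s θ ∈ dualBall 𝕜 (X 𝕜 F) := by
  intro x
  rw [sumFunctional_apply]
  refine (norm_sum_le_of_le s fun α _ => ?_).trans (X.sum_norm_coord_le hs x)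
  rw [norm_mul]
  exact mul_le_of_le_one_left (norm_nonneg _) (hθ α)

end Coordinates

/-! ### Coordinates of extreme points of the dual ball -/

section ExtremePoints

variable {𝕜 : Type*} [RCLike 𝕜] {κ : Type*} {F : Family κ}

/-- The functionals whose value at `e_β` can be replaced by any scalar of modulus at most one, the
other coordinates being kept, with a result in the dual ball. -/
def freeAt (𝕜 : Type*) [RCLike 𝕜] {κ : Type*} (F : Family κ) (β : κ) :
    Set (WeakDual 𝕜 (X 𝕜 F)) :=
  {f | ∀ c : 𝕜, ‖c‖ ≤ 1 →
    f + (c - f (X.e 𝕜 F β)) • X.coord 𝕜 F β ∈ dualBall 𝕜 (X 𝕜 F)}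

/-- The functionals in the dual ball that vanish at `e_β`. -/
def vanishingAt (𝕜 : Type*) [RCLike 𝕜] {κ : Type*} (F : Family κ) (β : κ) :
    Set (WeakDual 𝕜 (X 𝕜 F)) :=
  {f | f ∈ dualBall 𝕜 (X 𝕜 F) ∧ f (X.e 𝕜 F β) = 0}

theorem norm_apply_e_le {f : WeakDual 𝕜 (X 𝕜 F)} (hf : f ∈ dualBall 𝕜 (X 𝕜 F)) (β : κ) :
    ‖f (X.e 𝕜 F β)‖ ≤ 1 :=
  (hf _).trans (X.norm_e_le β)

theorem convex_vanishingAt (β : κ) : Convex ℝ (vanishingAt 𝕜 F β) := by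
  intro f hf g hg a b ha hb hab
  refine ⟨convex_dualBall hf.1 hg.1 ha hb hab, ?_⟩
  rw [weakDual_add_apply, weakDual_real_smul_apply, weakDual_real_smul_apply, hf.2, hg.2]
  simp

theorem isCompact_vanishingAt (β : κ) : IsCompact (vanishingAt 𝕜 F β) :=
  isCompact_dualBall.inter_right
    (isClosed_singleton.preimage (WeakDual.eval_continuous (X.e 𝕜 F β)) : IsClosed
      {f : WeakDual 𝕜 (X 𝕜 F) | f (X.e 𝕜 F β) ∈ ({0} : Set 𝕜)})

theorem convex_dualBall_inter_freeAt (β : κ) :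
    Convex ℝ (dualBall 𝕜 (X 𝕜 F) ∩ freeAt 𝕜 F β) := by
  intro f hf g hg a b ha hb hab
  refine ⟨convex_dualBall hf.1 hg.1 ha hb hab, fun c hc => ?_⟩
  convert convex_dualBall (hf.2 c hc) (hg.2 c hc) ha hb hab using 1
  refine DFunLike.ext _ _ fun x => ?_
  simp only [weakDual_add_apply, weakDual_real_smul_apply, weakDual_smul_apply,
    RCLike.real_smul_eq_coe_mul]
  have h : (a : 𝕜) + b = 1 := by rw [← RCLike.ofReal_add, hab, RCLike.ofReal_one]
  linear_combination -(c * X.coord 𝕜 F β x) * h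

theorem isCompact_dualBall_inter_freeAt (β : κ) :
    IsCompact (dualBall 𝕜 (X 𝕜 F) ∩ freeAt 𝕜 F β) := by
  refine isCompact_dualBall.inter_right ?_
  have hcont (c : 𝕜) : Continuous fun f : WeakDual 𝕜 (X 𝕜 F) =>
      f + (c - f (X.e 𝕜 F β)) • X.coord 𝕜 F β :=
    WeakDual.continuous_of_continuous_eval fun x => (WeakDual.eval_continuous x).add
      ((continuous_const.sub (WeakDual.eval_continuous (X.e 𝕜 F β))).mul continuous_const)
  have h : freeAt 𝕜 F β = ⋂ (c : 𝕜) (_ : ‖c‖ ≤ 1),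
      (fun f : WeakDual 𝕜 (X 𝕜 F) => f + (c - f (X.e 𝕜 F β)) • X.coord 𝕜 F β) ⁻¹'
        dualBall 𝕜 (X 𝕜 F) := by
    ext f
    simp [freeAt]
  rw [h]
  exact isClosed_iInter fun c => isClosed_iInter fun _ => isClosed_dualBall.preimage (hcont c)

theorem sumFunctional_mem_freeAt {s : Finset κ} (hs : s ∈ F.sets) {θ : κ → 𝕜}
    (hθ : ∀ α, ‖θ α‖ ≤ 1) {β : κ} (hβ : β ∈ s) :
    sumFunctional 𝕜 F s θ ∈ freeAt 𝕜 F β := by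
  classical
  intro c hc
  convert sumFunctional_mem_dualBall hs (θ := Function.update θ β c) ?_ using 1
  · refine X.functional_ext fun α => ?_
    simp only [weakDual_add_apply, weakDual_smul_apply, sumFunctional_e, X.coord_e, if_pos hβ,
      Function.update_apply]
    by_cases h : α = β
    · subst h
      simp [hβ]
    · simp [h]
  · intro α
    rw [Function.update_apply]
    split_ifs
    exacts [hc, hθ α]

/-- Every functional in the dual ball is a convex combination of one that vanishes at `e_β` and one
whose value at `e_β` is free. The functionals `∑_{α ∈ s} θ_α e*_α` with `s ∈ F` are of one of the
two kinds and they determine the norm, so this is a consequence of the Hahn–Banach theorem. -/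
theorem dualBall_subset_convexJoin (β : κ) :
    dualBall 𝕜 (X 𝕜 F) ⊆
      convexJoin ℝ (vanishingAt 𝕜 F β) (dualBall 𝕜 (X 𝕜 F) ∩ freeAt 𝕜 F β) := by
  classical
  intro f hf
  by_contra hfJ
  -- `x` separates `f` from the join; the norm of `x` is then at most `u < Re f(x)`
  obtain ⟨x, u, hJ, hu⟩ := exists_eval_separation_convexJoin (convex_vanishingAt β)
    (isCompact_vanishingAt β) (convex_dualBall_inter_freeAt β)
    (isCompact_dualBall_inter_freeAt β) hfJ
  have h0 : sumFunctional 𝕜 F ∅ (fun _ => 1) ∈ vanishingAt 𝕜 F β :=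
    ⟨sumFunctional_mem_dualBall (F.mem_of_card_le_one ∅ (by simp)) (by simp), by
      simp [sumFunctional_e]⟩
  have h1 : sumFunctional 𝕜 F {β} (fun _ => 1) ∈ dualBall 𝕜 (X 𝕜 F) ∩ freeAt 𝕜 F β :=
    ⟨sumFunctional_mem_dualBall (F.mem_of_card_le_one {β} (by simp)) (by simp),
      sumFunctional_mem_freeAt (F.mem_of_card_le_one {β} (by simp)) (by simp) (by simp)⟩
  have hx : ‖x‖ ≤ u := by
    refine X.norm_le fun s hs => ?_
    -- phases that turn the sum of the moduli into the value of a functional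
    choose θ hθ hθx using fun α => RCLike.exists_norm_eq_mul_self (X.coord 𝕜 F α x)
    have hball := sumFunctional_mem_dualBall hs (θ := θ) fun α => (hθ α).le
    have hmem : sumFunctional 𝕜 F s θ ∈
        convexJoin ℝ (vanishingAt 𝕜 F β) (dualBall 𝕜 (X 𝕜 F) ∩ freeAt 𝕜 F β) := by
      by_cases hβ : β ∈ s
      · exact subset_convexJoin_right ⟨_, h0⟩
          ⟨hball, sumFunctional_mem_freeAt hs (fun α => (hθ α).le) hβ⟩
      · exact subset_convexJoin_left ⟨_, h1⟩ ⟨hball, by rw [sumFunctional_e, if_neg hβ]⟩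
    have h := hJ _ hmem
    rw [sumFunctional_apply, Finset.sum_congr rfl fun α _ => (hθx α).symm,
      ← RCLike.ofReal_sum, RCLike.ofReal_re] at h
    exact h.le
  exact absurd ((RCLike.re_le_norm _).trans (hf x)) (not_le.mpr (hx.trans_lt hu))

/-- The coordinates of an extreme point of the dual ball have modulus `0` or `1`: an extreme point
is one of the two ends of the convex combination in `dualBall_subset_convexJoin`. -/
theorem norm_apply_e_of_mem_extremePoints {f : WeakDual 𝕜 (X 𝕜 F)}
    (hf : f ∈ (dualBall 𝕜 (X 𝕜 F)).extremePoints ℝ) (β : κ) :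
    ‖f (X.e 𝕜 F β)‖ = 0 ∨ ‖f (X.e 𝕜 F β)‖ = 1 := by
  obtain ⟨g, hg, h, hh, hfgh⟩ := mem_convexJoin.mp (dualBall_subset_convexJoin β hf.1)
  rcases (mem_extremePoints_iff_forall_segment.mp hf).2 g hg.1 h hh.1 hfgh with rfl | rfl
  · exact Or.inl (by rw [hg.2, norm_zero])
  · right
    -- a value of modulus less than one could be moved by `± δ`
    set δ : ℝ := 1 - ‖h (X.e 𝕜 F β)‖ with hδ
    have hδ0 : 0 ≤ δ := sub_nonneg.mpr (norm_apply_e_le hh.1 β)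
    have hmove (t : 𝕜) (ht : ‖t‖ ≤ δ) : h + t • X.coord 𝕜 F β ∈ dualBall 𝕜 (X 𝕜 F) := by
      have := hh.2 (h (X.e 𝕜 F β) + t) ((norm_add_le _ _).trans (by linarith))
      rwa [add_sub_cancel_left] at this
    have hmid : h ∈ openSegment ℝ (h + (δ : 𝕜) • X.coord 𝕜 F β)
        (h + (-δ : 𝕜) • X.coord 𝕜 F β) := by
      refine ⟨1 / 2, 1 / 2, by norm_num, by norm_num, by norm_num, ?_⟩
      rw [← smul_add, neg_smul, add_add_add_comm, add_neg_cancel, add_zero, ← two_smul ℝ h,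
        smul_smul]
      norm_num
    have heq := (mem_extremePoints_iff_left.mp hf).2 _
      (hmove δ (by rw [RCLike.norm_ofReal, abs_of_nonneg hδ0])) _
      (hmove (-δ) (by rw [norm_neg, RCLike.norm_ofReal, abs_of_nonneg hδ0])) hmid
    have h0 : (δ : 𝕜) = 0 := by
      have := congrArg (fun k : WeakDual 𝕜 (X 𝕜 F) => k (X.e 𝕜 F β)) heq
      simp only [weakDual_add_apply, weakDual_smul_apply, X.coord_e_self] at this
      simpa using this
    have : δ = 0 := by exact_mod_cast h0
    linarith

/-- The weak* limits of extreme points of the dual ball still have all their coordinates of modulus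
`0` or `1`. -/
theorem norm_apply_e_of_mem_extremeClosure {f : WeakDual 𝕜 (X 𝕜 F)}
    (hf : f ∈ extremeClosure 𝕜 (X 𝕜 F)) (β : κ) :
    ‖f (X.e 𝕜 F β)‖ = 0 ∨ ‖f (X.e 𝕜 F β)‖ = 1 := by
  have hcont : Continuous fun f : WeakDual 𝕜 (X 𝕜 F) => ‖f (X.e 𝕜 F β)‖ :=
    (WeakDual.eval_continuous (X.e 𝕜 F β)).norm
  have hclosed : IsClosed {f : WeakDual 𝕜 (X 𝕜 F) |
      ‖f (X.e 𝕜 F β)‖ = 0 ∨ ‖f (X.e 𝕜 F β)‖ = 1} :=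
    (isClosed_eq hcont continuous_const).union (isClosed_eq hcont continuous_const)
  exact closure_minimal (fun g hg => norm_apply_e_of_mem_extremePoints hg β) hclosed hf

end ExtremePoints

/-! ### Extreme points from maximal sets -/

section MaximalSets

variable {𝕜 : Type*} [RCLike 𝕜] {κ : Type*} {F : Family κ}

theorem eq_one_of_convex_combination {z w : 𝕜} (hz : ‖z‖ ≤ 1) (hw : ‖w‖ ≤ 1) {a b : ℝ}
    (ha : 0 < a) (hb : 0 < b) (hab : a + b = 1) (h : (a : 𝕜) * z + b * w = 1) : z = 1 := by
  have hre : a * RCLike.re z + b * RCLike.re w = 1 := by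
    simpa using congrArg RCLike.re h
  have hz1 : RCLike.re z = 1 := by
    have h1 := (RCLike.re_le_norm z).trans hz
    have h2 := (RCLike.re_le_norm w).trans hw
    nlinarith
  have hnorm : ‖z‖ ^ 2 ≤ 1 := pow_le_one₀ (norm_nonneg _) hz
  rw [RCLike.norm_sq_eq_def, hz1] at hnorm
  refine RCLike.ext (by simpa using hz1) ?_
  rw [RCLike.one_im]
  nlinarith [sq_nonneg (RCLike.im z)]

/-- For a maximal set `s` and `β ∉ s`, adding a multiple `c e_β` with `|c| ≤ 1` to the indicator of
`s` does not increase the norm: a member of `F` that contains `β` misses a point of `s`. -/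
theorem norm_indicator_add_le {s : Finset κ} (hs : s ∈ F.maxSets) {β : κ} (hβ : β ∉ s) {c : 𝕜}
    (hc : ‖c‖ ≤ 1) :
    ‖(∑ α ∈ s, X.e 𝕜 F α) + c • X.e 𝕜 F β‖ ≤ s.card := by
  classical
  refine X.norm_le fun t ht => ?_
  have hcoord (γ : κ) : X.coord 𝕜 F γ ((∑ α ∈ s, X.e 𝕜 F α) + c • X.e 𝕜 F β) =
      (if γ ∈ s then 1 else 0) + c * (if β = γ then 1 else 0) := by
    rw [map_add, map_sum, map_smul, X.coord_e, smul_eq_mul]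
    simp only [X.coord_e]
    rw [Finset.sum_ite_eq']
  have hle (γ : κ) : ‖X.coord 𝕜 F γ ((∑ α ∈ s, X.e 𝕜 F α) + c • X.e 𝕜 F β)‖ ≤
      if γ ∈ insert β s then 1 else 0 := by
    rw [hcoord]
    by_cases hγ : β = γ
    · subst hγ
      simpa [hβ] using hc
    · by_cases hγs : γ ∈ s <;> simp [hγ, hγs, Ne.symm hγ]
  refine (Finset.sum_le_sum fun γ _ => hle γ).trans ?_
  rw [← Finset.sum_filter, Finset.sum_const, nsmul_eq_mul, mul_one, Nat.cast_le]
  have hsub : t.filter (· ∈ insert β s) ⊆ insert β s := fun γ hγ => (Finset.mem_filter.mp hγ).2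
  have hne : t.filter (· ∈ insert β s) ≠ insert β s := by
    intro h
    refine hs.2 ⟨t, ht, (Finset.ssubset_insert hβ).trans_subset ?_⟩
    exact h ▸ Finset.filter_subset _ t
  have := Finset.card_lt_card (hsub.ssubset_of_ne hne)
  rw [Finset.card_insert_of_notMem hβ] at this
  omega

/-- A functional in the dual ball whose coordinates on a maximal set `s` are all `1` vanishes
off `s`. -/
theorem apply_e_eq_zero {s : Finset κ} (hs : s ∈ F.maxSets) {g : WeakDual 𝕜 (X 𝕜 F)}
    (hg : g ∈ dualBall 𝕜 (X 𝕜 F)) (hgs : ∀ α ∈ s, g (X.e 𝕜 F α) = 1) {β : κ} (hβ : β ∉ s) :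
    g (X.e 𝕜 F β) = 0 := by
  obtain ⟨c, hc, hcβ⟩ := RCLike.exists_norm_eq_mul_self (g (X.e 𝕜 F β))
  have h := (hg _).trans (norm_indicator_add_le hs hβ hc.le)
  rw [map_add, map_sum, map_smul, smul_eq_mul, ← hcβ, Finset.sum_congr rfl hgs,
    Finset.sum_const, nsmul_eq_mul, mul_one] at h
  have h' := (RCLike.re_le_norm _).trans h
  rw [map_add, RCLike.natCast_re, RCLike.ofReal_re] at h'
  exact norm_le_zero_iff.mp (by linarith)

/-- Maximal sets give extreme points: in a proper convex combination equal to `∑_{α ∈ s} e*_α`, both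
functionals have all coordinates on `s` equal to `1`, and maximality makes them vanish off `s`. -/
theorem sumFunctional_mem_extremePoints {s : Finset κ} (hs : s ∈ F.maxSets) :
    sumFunctional 𝕜 F s (fun _ => 1) ∈ (dualBall 𝕜 (X 𝕜 F)).extremePoints ℝ := by
  classical
  refine mem_extremePoints_iff_left.mpr ⟨sumFunctional_mem_dualBall hs.1 (by simp), ?_⟩
  rintro g hg h hh ⟨a, b, ha, hb, hab, hgh⟩
  have hgs : ∀ α ∈ s, g (X.e 𝕜 F α) = 1 := by
    intro α hα
    have hα' := congrArg (fun k : WeakDual 𝕜 (X 𝕜 F) => k (X.e 𝕜 F α)) hgh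
    simp only [weakDual_add_apply, weakDual_real_smul_apply, sumFunctional_e, if_pos hα,
      RCLike.real_smul_eq_coe_mul] at hα'
    exact eq_one_of_convex_combination (norm_apply_e_le hg α) (norm_apply_e_le hh α) ha hb hab hα'
  refine X.functional_ext fun α => ?_
  rw [sumFunctional_e]
  split_ifs with hα
  exacts [hgs α hα, apply_e_eq_zero hs hg hgs hα]

/-- If maximal sets converge to `{α}` in the Cantor cube, the corresponding extreme points converge
to `e*_α`: by compactness of the dual ball, convergence of the coordinates is enough. -/
theorem coord_mem_extremeClosure {α : κ} (hα : charFun {α} ∈ F.closureMax) :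
    X.coord 𝕜 F α ∈ extremeClosure 𝕜 (X 𝕜 F) := by
  classical
  set l : Filter (Finset κ) := comap charFun (𝓝 (charFun {α})) ⊓ 𝓟 F.maxSets with hl
  have hne : l.NeBot := by
    rw [hl, ← map_neBot_iff charFun, Filter.push_pull', map_principal]
    exact mem_closure_iff_clusterPt.mp hα
  have hmax : ∀ᶠ s in l, s ∈ F.maxSets := mem_inf_of_right (mem_principal_self _)
  have hmem (β : κ) : ∀ᶠ s in l, (β ∈ s ↔ β ∈ ({α} : Finset κ)) := by
    have h0 : Tendsto charFun l (𝓝 (charFun {α})) := tendsto_comap.mono_left inf_le_left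
    have h1 : Tendsto (fun s : Finset κ => charFun s β) l (𝓝 (charFun {α} β)) :=
      ((continuous_apply β).tendsto _).comp h0
    rw [nhds_discrete, tendsto_pure] at h1
    filter_upwards [h1] with s hs
    simpa [charFun] using hs
  have htendsto : Tendsto (fun s => sumFunctional 𝕜 F s (fun _ => 1)) l
      (𝓝 (X.coord 𝕜 F α)) := by
    refine isCompact_dualBall.tendsto_nhds_of_unique_mapClusterPt
      (hmax.mono fun s hs => sumFunctional_mem_dualBall hs.1 (by simp)) fun f _ hf => ?_
    refine X.functional_ext fun β => ?_
    have h1 := hf.tendsto_comp ((WeakDual.eval_continuous (X.e 𝕜 F β)).tendsto f)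
    by_contra hne
    obtain ⟨s, hs, hsβ⟩ :=
      ((h1.frequently (isOpen_ne.mem_nhds hne)).and_eventually (hmem β)).exists
    refine hs ?_
    simp [sumFunctional_e, X.coord_e, hsβ, eq_comm]
  exact mem_closure_of_tendsto htendsto (hmax.mono fun s hs => sumFunctional_mem_extremePoints hs)

end MaximalSets

/-! ### Reflections in a coordinate -/

section Reflection

variable {𝕜 : Type*} [RCLike 𝕜] {κ : Type*} {F : Family κ}

/-- The linear map that changes the sign of the coordinate `β`. -/
noncomputable def reflectionLinear (𝕜 : Type*) [RCLike 𝕜] {κ : Type*} (F : Family κ) (β : κ) :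
    X 𝕜 F →ₗ[𝕜] X 𝕜 F :=
  LinearMap.id - (2 : 𝕜) •
    (WeakDual.toStrongDual (X.coord 𝕜 F β) : X 𝕜 F →L[𝕜] 𝕜).toLinearMap.smulRight (X.e 𝕜 F β)

theorem reflectionLinear_apply (β : κ) (x : X 𝕜 F) :
    reflectionLinear 𝕜 F β x = x - (2 : 𝕜) • X.coord 𝕜 F β x • X.e 𝕜 F β := rfl

theorem coord_reflectionLinear [DecidableEq κ] (β γ : κ) (x : X 𝕜 F) :
    X.coord 𝕜 F γ (reflectionLinear 𝕜 F β x) =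
      if β = γ then -X.coord 𝕜 F γ x else X.coord 𝕜 F γ x := by
  rw [reflectionLinear_apply, map_sub, map_smul, map_smul, X.coord_e]
  split_ifs with h
  · subst h
    simp only [smul_eq_mul]
    ring
  · simp

/-- The reflection in the coordinate `β`, a linear isometry of `X_F`. -/
noncomputable def reflection (𝕜 : Type*) [RCLike 𝕜] {κ : Type*} (F : Family κ) (β : κ) :
    X 𝕜 F ≃ₗᵢ[𝕜] X 𝕜 F where
  toLinearEquiv := LinearEquiv.ofInvolutive (reflectionLinear 𝕜 F β) fun x => by
    classical
    refine X.coord_ext fun γ => ?_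
    simp only [coord_reflectionLinear]
    split_ifs <;> simp
  norm_map' x := by
    classical
    have h (y : X 𝕜 F) (γ : κ) :
        ‖X.coord 𝕜 F γ (reflectionLinear 𝕜 F β y)‖ = ‖X.coord 𝕜 F γ y‖ := by
      rw [coord_reflectionLinear]
      split_ifs <;> simp
    refine le_antisymm (X.norm_le fun s hs => ?_) (X.norm_le fun s hs => ?_)
    · exact (Finset.sum_congr rfl fun γ _ => h x γ).trans_le (X.sum_norm_coord_le hs x)
    · exact (Finset.sum_congr rfl fun γ _ => (h x γ).symm).trans_le (X.sum_norm_coord_le hs _)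

/-- Reflecting the coordinate `β` of a functional preserves weak* limits of extreme points. -/
theorem sub_smul_coord_mem_extremeClosure {f : WeakDual 𝕜 (X 𝕜 F)}
    (hf : f ∈ extremeClosure 𝕜 (X 𝕜 F)) (β : κ) :
    f - (2 * f (X.e 𝕜 F β)) • X.coord 𝕜 F β ∈ extremeClosure 𝕜 (X 𝕜 F) := by
  convert adjoint_mem_extremeClosure (reflection 𝕜 F β) hf using 1
  refine DFunLike.ext _ _ fun x => ?_
  change f x - 2 * f (X.e 𝕜 F β) * X.coord 𝕜 F β x = f (reflectionLinear 𝕜 F β x)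
  rw [reflectionLinear_apply, map_sub, map_smul, map_smul, smul_eq_mul, smul_eq_mul]
  ring

end Reflection

/-! ### Isometries permute the unit vectors -/

section Isometries

variable {𝕜 : Type*} [RCLike 𝕜] {κ : Type*} {F G : Family κ}

/-- The adjoint of a surjective isometry sends coordinate functionals to unimodular multiples of
coordinate functionals. The statement is written for the inverse: `e*_β ∘ T⁻¹ = c e*_α`, where `β`
is any coordinate at which `e*_α ∘ T` does not vanish. -/
theorem exists_coord_comp_isometry
    (hF : ∀ α : κ, charFun {α} ∈ F.closureMax) (hG : ∀ α : κ, charFun {α} ∈ G.closureMax)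
    (T : X 𝕜 F ≃ₗᵢ[𝕜] X 𝕜 G) (α : κ) :
    ∃ (β : κ) (c : 𝕜), ‖c‖ = 1 ∧ ∀ y, X.coord 𝕜 F β (T.symm y) = c * X.coord 𝕜 G α y := by
  set g : WeakDual 𝕜 (X 𝕜 F) := adjoint T (X.coord 𝕜 G α) with hg
  have hgK : g ∈ extremeClosure 𝕜 (X 𝕜 F) :=
    adjoint_mem_extremeClosure T (coord_mem_extremeClosure (hG α))
  have hg0 : g ≠ 0 := by
    intro h
    have h1 : X.coord 𝕜 G α (T (T.symm (X.e 𝕜 G α))) = 0 :=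
      congrArg (fun k : WeakDual 𝕜 (X 𝕜 F) => k (T.symm (X.e 𝕜 G α))) h
    rw [T.apply_symm_apply, X.coord_e_self] at h1
    exact one_ne_zero h1
  obtain ⟨β, hβ⟩ : ∃ β, g (X.e 𝕜 F β) ≠ 0 := by
    by_contra! h
    exact hg0 (X.functional_ext fun β => h β)
  have hβ1 : ‖g (X.e 𝕜 F β)‖ = 1 :=
    (norm_apply_e_of_mem_extremeClosure hgK β).resolve_left (norm_ne_zero_iff.mpr hβ)
  set f : WeakDual 𝕜 (X 𝕜 G) := (adjoint T).symm (X.coord 𝕜 F β) with hf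
  have hfK : f ∈ extremeClosure 𝕜 (X 𝕜 G) :=
    adjoint_symm_mem_extremeClosure T (coord_mem_extremeClosure (hF β))
  -- pull back the reflection of `g` in the coordinate `β`
  have hfr : X.coord 𝕜 G α - (2 * g (X.e 𝕜 F β)) • f ∈ extremeClosure 𝕜 (X 𝕜 G) := by
    have h := adjoint_symm_mem_extremeClosure T (sub_smul_coord_mem_extremeClosure hgK β)
    rwa [map_sub, map_smul, hg, LinearEquiv.symm_apply_apply, ← hg, ← hf] at h
  -- off `α` the coordinates of `f` and twice these coordinates both have modulus `0` or `1`
  have hzero (γ : κ) (hγ : γ ≠ α) : f (X.e 𝕜 G γ) = 0 := by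
    have h1 := norm_apply_e_of_mem_extremeClosure hfK γ
    have h2 := norm_apply_e_of_mem_extremeClosure hfr γ
    rw [weakDual_sub_apply, weakDual_smul_apply, X.coord_e_of_ne hγ.symm, zero_sub, norm_neg,
      norm_mul, norm_mul, hβ1, RCLike.norm_two] at h2
    rcases h1 with h1 | h1
    · exact norm_eq_zero.mp h1
    · rw [h1] at h2
      norm_num at h2
  have hfα : f = f (X.e 𝕜 G α) • X.coord 𝕜 G α := by
    refine X.functional_ext fun γ => ?_
    rw [weakDual_smul_apply]
    by_cases hγ : γ = α
    · rw [hγ, X.coord_e_self, mul_one]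
    · rw [hzero γ hγ, X.coord_e_of_ne (Ne.symm hγ), mul_zero]
  refine ⟨β, f (X.e 𝕜 G α), ?_, fun y => ?_⟩
  · refine (norm_apply_e_of_mem_extremeClosure hfK α).resolve_left fun h => ?_
    have h0 : f = 0 := by
      rw [hfα, norm_eq_zero.mp h, zero_smul]
    have h1 : f (T (X.e 𝕜 F β)) = X.coord 𝕜 F β (T.symm (T (X.e 𝕜 F β))) := rfl
    rw [h0, T.symm_apply_apply, X.coord_e_self] at h1
    exact one_ne_zero h1.symm
  · exact congrArg (fun k : WeakDual 𝕜 (X 𝕜 G) => k y) hfα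

end Isometries

end CombinatorialSpace

open CombinatorialSpace in
theorem theorem2p6 {𝕜 : Type*} [RCLike 𝕜] {κ : Type*} [Infinite κ]
    (F G : CombinatorialSpace.Family κ)
    (hFcompact : F.Compact) (hFhered : F.Hereditary)
    (hGcompact : G.Compact) (hGhered : G.Hereditary)
    (hFmax : ∀ α : κ, CombinatorialSpace.charFun {α} ∈ F.closureMax)
    (hGmax : ∀ α : κ, CombinatorialSpace.charFun {α} ∈ G.closureMax)
    (T : CombinatorialSpace.X 𝕜 F ≃ₗᵢ[𝕜] CombinatorialSpace.X 𝕜 G) :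
    ∃ (π : Equiv.Perm κ) (θ : κ → 𝕜), (∀ α, ‖θ α‖ = 1) ∧
      ∀ α, T (CombinatorialSpace.X.e 𝕜 F α) =
        θ α • CombinatorialSpace.X.e 𝕜 G (π α) := by
  choose σ c hc hσ using exists_coord_comp_isometry hFmax hGmax T
  choose τ d hd hτ using exists_coord_comp_isometry hGmax hFmax T.symm
  have hne {z : 𝕜} (hz : ‖z‖ = 1) : z ≠ 0 := norm_ne_zero_iff.mp (hz ▸ one_ne_zero)
  have hστ (β : κ) : σ (τ β) = β := by
    by_contra h
    have h1 := hσ (τ β) (T (X.e 𝕜 F β))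
    have h2 := hτ β (X.e 𝕜 F β)
    rw [LinearIsometryEquiv.symm_symm, X.coord_e_self, mul_one] at h2
    rw [T.symm_apply_apply, X.coord_e_of_ne h, h2] at h1
    exact mul_ne_zero (hne (hc _)) (hne (hd _)) h1.symm
  have hτσ (α : κ) : τ (σ α) = α := by
    by_contra h
    have h1 := hτ (σ α) (T.symm (X.e 𝕜 G α))
    have h2 := hσ α (X.e 𝕜 G α)
    rw [X.coord_e_self, mul_one] at h2
    rw [LinearIsometryEquiv.symm_symm, T.apply_symm_apply, X.coord_e_of_ne h, h2] at h1
    exact mul_ne_zero (hne (hd _)) (hne (hc _)) h1.symm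
  refine ⟨⟨τ, σ, hστ, hτσ⟩, d, hd, fun α => X.coord_ext fun γ => ?_⟩
  have h := hτ (σ γ) (X.e 𝕜 F α)
  rw [LinearIsometryEquiv.symm_symm, hτσ] at h
  rw [h, map_smul, smul_eq_mul, Equiv.coe_fn_mk]
  by_cases hγ : σ γ = α
  · rw [hγ, X.coord_e_self, ← hγ, hτσ, X.coord_e_self]
  · have hγ' : γ ≠ τ α := by
      rintro rfl
      exact hγ (hστ α)
    rw [X.coord_e_of_ne hγ, X.coord_e_of_ne hγ', mul_zero, mul_zero]
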